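/- A convex body in $\mathbb{R}^n$ is a compact convex set with non-empty interior; $\lambda_K$ denotes the uniform probability measure on $K$. A convex body $K$ in $\mathbb{R}^n$ is called isotropic if it has volume one, its barycenter is at the origin, and ${\rm Cov}(\lambda_K) = L^2\, {\rm Id}$ for some $L>0$. The isotropic constant of a convex body $K$ in $\mathbb{R}^n$ is $$L_K := \frac{(\det {\rm Cov}(\lambda_K))^{1/(2n)}}{{\rm Vol}(K)^{1/n}},$$ which equals the above $L$ when $K$ is isotropic. Let $B_2^n$ be the closed Euclidean unit ball, let $N(K, tB_2^n)$ be the minimal number of translates of $tB_2^n$ whose union covers $K$, and let $$e_k(K) := \min\{t>0 : N(K,tB_2^n)\le 2^k\}$$ be the $k$-th entropy number of $K$. For integers $m, n \geq 1$ denote $$e_m^\wedge := \sup\{ e_m(K)/\sqrt{m} : K \text{ is an isotropic convex body in } \mathbb{R}^m\}, \qquad L_n := \sup\{L_K : K \text{ is a convex body in } \mathbb{R}^n\}.$$ **Proposition.** There is a universal constant $C>0$ such that for every integer $n\ge 1$: 1. $\displaystyle L_n \le \inf_{\lambda\in(0,1]} C^{1/\lambda}\,\bigl(e^\wedge_{\lfloor(1+\lambda)n\rfloor}\bigr)^{1+\lambda}$;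 2. for every isotropic convex body $K$ in $\mathbb{R}^n$, $e_n(K)\le C\, L_K \sqrt{n}$; 3. consequently, $e_n^\wedge\le C\, L_n$. -/

import Mathlib

open MeasureTheory ProbabilityTheory
open scoped ENNReal

noncomputable section

/-- A convex body in `ℝⁿ`: a compact convex set with non-empty interior. -/
structure IsConvexBody {n : ℕ} (K : Set (EuclideanSpace ℝ (Fin n))) : Prop where
  convex : Convex ℝ K
  isCompact : IsCompact K
  interior_nonempty : (interior K).Nonempty

/-- The uniform probability measure on `K`: Lebesgue measure restricted to `K` and normalized. -/
def uniformMeasure {n : ℕ} (K : Set (EuclideanSpace ℝ (Fin n))) :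
    Measure (EuclideanSpace ℝ (Fin n)) :=
  (volume : Measure (EuclideanSpace ℝ (Fin n)))[|K]

/-- The covariance matrix `Cov(μ)`, with entries the covariances of the coordinates `x i`, `x j`
under `μ`. -/
def covarianceMatrix {n : ℕ} (μ : Measure (EuclideanSpace ℝ (Fin n))) : Matrix (Fin n) (Fin n) ℝ :=
  Matrix.of fun i j => cov[fun x => x i, fun x => x j; μ]

/-- An isotropic convex body: volume one, barycenter at the origin, and covariance matrix of the
form `L² Id` for some `L > 0`. -/
structure IsIsotropic {n : ℕ} (K : Set (EuclideanSpace ℝ (Fin n))) : Prop where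
  isConvexBody : IsConvexBody K
  volume_eq_one : volume K = 1
  barycenter_eq_zero : ∫ x, x ∂(uniformMeasure K) = 0
  cov_eq : ∃ L : ℝ, 0 < L ∧ covarianceMatrix (uniformMeasure K) = L ^ 2 • (1 : Matrix (Fin n) (Fin n) ℝ)

/-- The isotropic constant `L_K = det(Cov(λ_K))^{1/(2n)} / Vol(K)^{1/n}` of a convex body `K` in
`ℝⁿ`, where `λ_K` is the uniform probability measure on `K` (whose density has sup-norm
`1 / Vol(K)`). If `K` is isotropic, this is the `L > 0` with `Cov(λ_K) = L² Id`. -/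
def isotropicConstant {n : ℕ} (K : Set (EuclideanSpace ℝ (Fin n))) : ℝ :=
  (covarianceMatrix (uniformMeasure K)).det ^ (1 / (2 * (n : ℝ))) / (volume K).toReal ^ (1 / (n : ℝ))

/-- The formula for the isotropic constant recovers the constant in the definition of isotropicity. -/
theorem isotropicConstant_eq {n : ℕ} (hn : 1 ≤ n) {K : Set (EuclideanSpace ℝ (Fin n))}
    (hvol : volume K = 1) {L : ℝ} (hL : 0 < L)
    (hcov : covarianceMatrix (uniformMeasure K) = L ^ 2 • (1 : Matrix (Fin n) (Fin n) ℝ)) :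
    isotropicConstant K = L := by
  have hn' : (n : ℝ) ≠ 0 := by positivity
  have h : (L ^ 2) ^ n = L ^ (2 * (n : ℝ)) := by
    rw [← pow_mul, ← Real.rpow_natCast]
    push_cast
    rfl
  rw [isotropicConstant, hvol, hcov, Matrix.det_smul, Matrix.det_one, Fintype.card_fin, mul_one, h,
    ← Real.rpow_mul hL.le, mul_one_div_cancel (by positivity)]
  simp

/-- The `k`-th entropy number `e_k(K) = min {t > 0 ; N(K, t B₂ⁿ) ≤ 2^k}`. The external covering
number is the minimal number of closed balls of radius `t`, with arbitrary centers in `ℝⁿ`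
(that is, of translates of `t B₂ⁿ`), whose union covers `K`. -/
def entropyNumber {n : ℕ} (k : ℕ) (K : Set (EuclideanSpace ℝ (Fin n))) : ℝ :=
  sInf {t : ℝ | 0 < t ∧ Metric.externalCoveringNumber t.toNNReal K ≤ 2 ^ k}

/-- The supremum of `e_m(K) / √m` over all isotropic convex bodies `K` in `ℝᵐ`. -/
def maxEntropyNumber (m : ℕ) : ℝ≥0∞ :=
  ⨆ (K : Set (EuclideanSpace ℝ (Fin m))) (_ : IsIsotropic K),
    ENNReal.ofReal (entropyNumber m K / √(m : ℝ))

/-- The supremum `L_n` of the isotropic constants of all convex bodies in `ℝⁿ`. -/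
def maxIsotropicConstant (n : ℕ) : ℝ≥0∞ :=
  ⨆ (K : Set (EuclideanSpace ℝ (Fin n))) (_ : IsConvexBody K),
    ENNReal.ofReal (isotropicConstant K)

end

noncomputable section

/-! Bounding `L_K` by entropy: put `K` in a position `K'` with covariance `(b²/12) Id` and multiply
it by the cube `[-b/2, b/2]ᵏ`, where `n + k = ⌊(1+λ)n⌋`. An interval of length `b` has variance
`b²/12`, so the product `T` has scalar covariance, and it has volume one exactly when `b^(n+k) =
(√12 L_K)^n`. If `2^(n+k)` balls of radius `t` cover `T`, their projections cover the cube;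
comparing volumes in dimension `k` gives `b ≤ C^(1/λ) e_{n+k}(T)/√(n+k)`, since `(n+k)/k` is of
order `1/λ`. Raising to the power `(n+k)/n ≤ 1+λ` bounds `L_K`. When `k = 0`, `n < 1/λ`, and a crude
one-dimensional estimate, losing a factor exponential in `n`, is enough.

Bounding entropy by `L_K`: by Chebyshev, three quarters of an isotropic `K` lies in the ball of
radius `s = 2 L_K √n`. For `4s`-separated points `x` of `K`, the sets `x/3 + (2/3)(K ∩ sB)` are
disjoint and lie in `K` by convexity. Comparing volumes leaves at most `2^n` points, and a maximal
separated set is a cover. The third statement follows by taking suprema.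

The main lemmas are `IsConvexBody.exists_scaled_isotropic_position`, `le_entropyNumber_prodCube` and
`encard_le_of_isSeparated_of_volume`. -/

theorem cond_map_measurableEquiv {X Y : Type*} [MeasurableSpace X] [MeasurableSpace Y]
    {μ : Measure X} {ν : Measure Y} (f : X ≃ᵐ Y) {c : ℝ≥0∞} (hc : c ≠ 0) (hc' : c ≠ ⊤)
    (h : μ.map f = c • ν) {S : Set X} (hS : MeasurableSet S) :
    (μ[|S]).map f = ν[|f '' S] := by
  have hvol : ∀ s : Set X, μ s = c * ν (f '' s) := fun s => by
    have := congrArg (fun m => m (f '' s)) h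
    simpa [f.map_apply, Set.preimage_image_eq _ f.injective] using this
  ext s hs
  rw [f.map_apply, cond_apply hS, cond_apply (f.measurableSet_image.2 hS), hvol S, hvol (S ∩ f ⁻¹' s),
    Set.image_inter_preimage, ENNReal.mul_inv (.inl hc) (.inl hc')]
  calc c⁻¹ * (ν (f '' S))⁻¹ * (c * ν (f '' S ∩ s))
      = (c⁻¹ * c) * ((ν (f '' S))⁻¹ * ν (f '' S ∩ s)) := by ring
    _ = _ := by rw [ENNReal.inv_mul_cancel hc hc', one_mul]

/-! ### Moments and covariance of a convex body -/

namespace IsConvexBody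

variable {n : ℕ} {K : Set (EuclideanSpace ℝ (Fin n))}

theorem measurableSet (hK : IsConvexBody K) : MeasurableSet K := hK.isCompact.measurableSet

theorem volume_ne_top (hK : IsConvexBody K) : volume K ≠ ⊤ := hK.isCompact.measure_ne_top

theorem volume_ne_zero (hK : IsConvexBody K) : volume K ≠ 0 :=
  (Measure.measure_pos_of_nonempty_interior _ hK.interior_nonempty).ne'

theorem nonempty (hK : IsConvexBody K) : K.Nonempty := hK.interior_nonempty.mono interior_subset

theorem isProbabilityMeasure (hK : IsConvexBody K) : IsProbabilityMeasure (uniformMeasure K) :=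
  cond_isProbabilityMeasure_of_finite hK.volume_ne_zero hK.volume_ne_top

theorem memLp_of_continuous (hK : IsConvexBody K) {f : EuclideanSpace ℝ (Fin n) → ℝ}
    (hf : Continuous f) (p : ℝ≥0∞) : MemLp f p (uniformMeasure K) := by
  have := hK.isProbabilityMeasure
  obtain ⟨c, hc⟩ := hK.isCompact.exists_bound_of_continuousOn hf.continuousOn
  exact MemLp.of_bound hf.aestronglyMeasurable c
    ((ae_cond_mem hK.measurableSet).mono fun x hx => hc x hx)

theorem memLp_coord (hK : IsConvexBody K) (i : Fin n) (p : ℝ≥0∞) :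
    MemLp (fun x => x i) p (uniformMeasure K) :=
  hK.memLp_of_continuous (by fun_prop) p

/-- Zero variance would make `⟨v, ·⟩` almost everywhere constant on `K`. But moving an interior
point slightly along `v` changes the value, so the interior contains a nonempty open set, of
positive volume, where the constant is missed. -/
theorem variance_inner_pos (hK : IsConvexBody K) {v : EuclideanSpace ℝ (Fin n)} (hv : v ≠ 0) :
    0 < Var[fun x => inner ℝ v x; uniformMeasure K] := by
  have := hK.isProbabilityMeasure
  have hcont : Continuous fun x : EuclideanSpace ℝ (Fin n) => inner ℝ v x := by fun_prop
  have hL := hK.memLp_of_continuous hcont 2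
  refine lt_of_le_of_ne (variance_nonneg _ _) fun h0 => ?_
  have h1 : eVar[fun x => inner ℝ v x; uniformMeasure K] = 0 := by
    rw [← hL.ofReal_variance_eq, ← h0, ENNReal.ofReal_zero]
  rw [evariance_eq_zero_iff hcont.aemeasurable] at h1
  set c := ∫ x, inner ℝ v x ∂(uniformMeasure K) with hc
  obtain ⟨x0, hx0⟩ := hK.interior_nonempty
  set U := interior K ∩ {x | inner ℝ v x ≠ c} with hU
  have hUo : IsOpen U := isOpen_interior.inter (isOpen_ne_fun hcont continuous_const)
  have hUne : U.Nonempty := by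
    by_cases hx : inner ℝ v x0 = c
    · have htend : Filter.Tendsto (fun t : ℝ => x0 + t • v) (nhdsWithin 0 {0}ᶜ) (nhds x0) := by
        have : Continuous fun t : ℝ => x0 + t • v := by fun_prop
        simpa using (this.tendsto 0).mono_left nhdsWithin_le_nhds
      have h2 := htend.eventually (isOpen_interior.mem_nhds hx0)
      obtain ⟨t, ht, ht0⟩ := (h2.and self_mem_nhdsWithin).exists
      refine ⟨x0 + t • v, ht, ?_⟩
      have ht0' : t ≠ 0 := by simpa using ht0
      simp only [Set.mem_ofPred_eq, inner_add_right, inner_smul_right, hx, ne_eq, add_eq_left,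
        mul_eq_zero, ht0', inner_self_eq_zero, hv, or_self, not_false_eq_true]
    · exact ⟨x0, hx0, hx⟩
  have hpos := hUo.measure_pos volume hUne
  have hzero : uniformMeasure K U = 0 :=
    measure_mono_null (fun x hx => hx.2) h1
  rw [uniformMeasure, cond_apply hK.measurableSet,
    Set.inter_eq_right.2 (Set.inter_subset_left.trans interior_subset), mul_eq_zero,
    ENNReal.inv_eq_zero] at hzero
  exact hzero.elim hK.volume_ne_top hpos.ne'

/-- The quadratic form of the covariance matrix at `x` is the variance of `⟨x, ·⟩`. -/
theorem posDef_covarianceMatrix (hK : IsConvexBody K) :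
    (covarianceMatrix (uniformMeasure K)).PosDef := by
  have := hK.isProbabilityMeasure
  refine Matrix.PosDef.of_dotProduct_mulVec_pos ?_ fun x hx => ?_
  · ext i j
    exact covariance_comm _ _
  · have h := hK.variance_inner_pos (v := WithLp.toLp 2 x) (by simpa using hx)
    have e : (fun y : EuclideanSpace ℝ (Fin n) => inner ℝ (WithLp.toLp 2 x) y)
        = fun y => ∑ i, x i * y i := by
      ext y
      simp [PiLp.inner_apply, mul_comm]
    rw [e, ← covariance_self (by fun_prop), covariance_fun_sum_fun_sum
      (fun i => (hK.memLp_coord i 2).const_mul (x i)) (fun i => (hK.memLp_coord i 2).const_mul (x i))] at h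
    refine h.trans_eq ?_
    simp only [star_trivial, dotProduct, Matrix.mulVec, covarianceMatrix, Matrix.of_apply,
      Finset.mul_sum, covariance_const_mul_left, covariance_const_mul_right]
    exact Finset.sum_congr rfl fun i _ => Finset.sum_congr rfl fun j _ => by ring

theorem isotropicConstant_pos (hK : IsConvexBody K) : 0 < isotropicConstant K :=
  div_pos (Real.rpow_pos_of_pos hK.posDef_covarianceMatrix.det_pos _)
    (Real.rpow_pos_of_pos (ENNReal.toReal_pos hK.volume_ne_zero hK.volume_ne_top) _)

theorem isotropicConstant_pow (hn : 1 ≤ n) (hK : IsConvexBody K) :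
    isotropicConstant K ^ n
      = √(covarianceMatrix (uniformMeasure K)).det / (volume K).toReal := by
  have hd := hK.posDef_covarianceMatrix.det_pos
  have hn' : (n : ℝ) ≠ 0 := by positivity
  rw [isotropicConstant, div_pow, ← Real.rpow_natCast, ← Real.rpow_natCast, ← Real.rpow_mul hd.le,
    ← Real.rpow_mul ENNReal.toReal_nonneg, one_div_mul_cancel hn', Real.rpow_one, Real.sqrt_eq_rpow]
  congr 2
  field_simp

end IsConvexBody

/-! ### Affine images and isotropic position -/

theorem det_toEuclideanLin {n : ℕ} (A : Matrix (Fin n) (Fin n) ℝ) :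
    LinearMap.det (Matrix.toEuclideanLin A) = A.det := by
  change LinearMap.det (Matrix.toLpLin 2 2 A) = A.det
  rw [Matrix.toLpLin_eq_toLin, LinearMap.det_toLin]

/-- Invertible affine maps given by a matrix and a shift. -/
def matrixAffineHomeomorph {n : ℕ} (A : Matrix (Fin n) (Fin n) ℝ) (hA : A.det ≠ 0)
    (p : EuclideanSpace ℝ (Fin n)) : EuclideanSpace ℝ (Fin n) ≃ₜ EuclideanSpace ℝ (Fin n) :=
  (Homeomorph.subRight p).trans
    (LinearMap.equivOfDetNeZero (Matrix.toEuclideanLin A) (by rwa [det_toEuclideanLin])).toContinuousLinearEquiv.toHomeomorph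

variable {n : ℕ} (A : Matrix (Fin n) (Fin n) ℝ) (hA : A.det ≠ 0) (p : EuclideanSpace ℝ (Fin n))

theorem matrixAffineHomeomorph_apply (x : EuclideanSpace ℝ (Fin n)) :
    matrixAffineHomeomorph A hA p x = Matrix.toEuclideanLin A (x - p) := rfl

theorem matrixAffineHomeomorph_apply_coord (x : EuclideanSpace ℝ (Fin n)) (i : Fin n) :
    matrixAffineHomeomorph A hA p x i = ∑ j, A i j * (x j - p j) := by
  simp [matrixAffineHomeomorph_apply, Matrix.toLpLin_apply, Matrix.mulVec, dotProduct]

theorem volume_image_matrixAffineHomeomorph (K : Set (EuclideanSpace ℝ (Fin n))) :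
    volume (matrixAffineHomeomorph A hA p '' K) = ENNReal.ofReal |A.det| * volume K := by
  have : matrixAffineHomeomorph A hA p '' K
      = Matrix.toEuclideanLin A '' ((fun x => x + -p) '' K) := by
    rw [Set.image_image]
    exact Set.image_congr fun x _ => by rw [matrixAffineHomeomorph_apply, sub_eq_add_neg]
  rw [this, Measure.addHaar_image_linearMap, det_toEuclideanLin, Set.image_add_right,
    measure_preimage_add_right]

theorem uniformMeasure_image_matrixAffineHomeomorph {K : Set (EuclideanSpace ℝ (Fin n))}
    (hK : MeasurableSet K) :
    uniformMeasure (matrixAffineHomeomorph A hA p '' K)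
      = (uniformMeasure K).map (matrixAffineHomeomorph A hA p) := by
  -- An affine map pushes Lebesgue measure to its multiple by `|det A|⁻¹`; the multiple disappears
  -- on normalizing.
  refine (cond_map_measurableEquiv (matrixAffineHomeomorph A hA p).toMeasurableEquiv
    (c := (ENNReal.ofReal |A.det|)⁻¹) (by simp) (by simpa using hA) ?_ hK).symm
  ext s hs
  rw [MeasurableEquiv.map_apply, Measure.smul_apply]
  have := volume_image_matrixAffineHomeomorph A hA p (matrixAffineHomeomorph A hA p ⁻¹' s)
  rw [Set.image_preimage_eq _ (matrixAffineHomeomorph A hA p).surjective] at this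
  rw [this, smul_eq_mul, ← mul_assoc, ENNReal.inv_mul_cancel (by simpa using hA) (by simp), one_mul]
  rfl

theorem IsConvexBody.image_matrixAffineHomeomorph {K : Set (EuclideanSpace ℝ (Fin n))}
    (hK : IsConvexBody K) : IsConvexBody (matrixAffineHomeomorph A hA p '' K) where
  convex := by
    have : matrixAffineHomeomorph A hA p '' K
        = Matrix.toEuclideanLin A '' ((fun x => x + -p) '' K) := by
      rw [Set.image_image]
      exact Set.image_congr fun x _ => by rw [matrixAffineHomeomorph_apply, sub_eq_add_neg]
    rw [this]
    have h2 : Convex ℝ ((fun x => x + -p) '' K) := by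
      simpa [add_comm] using hK.convex.translate (-p)
    exact h2.linear_image _
  isCompact := hK.isCompact.image (matrixAffineHomeomorph A hA p).continuous
  interior_nonempty := by
    rw [← Homeomorph.image_interior]
    exact hK.interior_nonempty.image _

theorem covarianceMatrix_image_matrixAffineHomeomorph {K : Set (EuclideanSpace ℝ (Fin n))}
    (hK : IsConvexBody K) :
    covarianceMatrix (uniformMeasure (matrixAffineHomeomorph A hA p '' K))
      = A * covarianceMatrix (uniformMeasure K) * A.transpose := by
  have := hK.isProbabilityMeasure
  have hL : ∀ i j : Fin n, MemLp (fun x : EuclideanSpace ℝ (Fin n) => A i j * (x j - p j)) 2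
      (uniformMeasure K) := fun i j => hK.memLp_of_continuous (by fun_prop) 2
  ext i j
  rw [uniformMeasure_image_matrixAffineHomeomorph A hA p hK.measurableSet]
  simp only [covarianceMatrix, Matrix.of_apply]
  rw [covariance_map_fun (by fun_prop) (by fun_prop)
    (matrixAffineHomeomorph A hA p).continuous.aemeasurable]
  simp only [matrixAffineHomeomorph_apply_coord]
  rw [covariance_fun_sum_fun_sum (hL i) (hL j)]
  have hi : ∀ k, Integrable (fun x : EuclideanSpace ℝ (Fin n) => x k) (uniformMeasure K) :=
    fun k => (hK.memLp_coord k 1).integrable le_rfl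
  simp only [covariance_const_mul_left, covariance_const_mul_right,
    Matrix.mul_apply, Matrix.transpose_apply, Matrix.of_apply, Finset.sum_mul]
  rw [Finset.sum_comm]
  refine Finset.sum_congr rfl fun k _ => Finset.sum_congr rfl fun l _ => ?_
  rw [covariance_sub_const_left (hi _), covariance_sub_const_right (hi _)]
  ring

-- Writing the covariance as `B Bᵀ`, the map `x ↦ σ B⁻¹ (x - p)` with `p` the barycenter makes it
-- `σ² Id` and scales volume by `σⁿ / |det B|`. The covariance rather than the volume is prescribed,
-- since it must later match that of a cube.
open scoped MatrixOrder in
theorem IsConvexBody.exists_scaled_isotropic_position (hn : 1 ≤ n)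
    {K : Set (EuclideanSpace ℝ (Fin n))} (hK : IsConvexBody K) {σ : ℝ} (hσ : 0 < σ) :
    ∃ K' : Set (EuclideanSpace ℝ (Fin n)), IsConvexBody K' ∧
      (∀ i, ∫ x, x i ∂(uniformMeasure K') = 0) ∧
      covarianceMatrix (uniformMeasure K') = σ ^ 2 • (1 : Matrix (Fin n) (Fin n) ℝ) ∧
      (volume K').toReal = (σ / isotropicConstant K) ^ n := by
  have := hK.isProbabilityMeasure
  set S := covarianceMatrix (uniformMeasure K) with hS
  have hSp : S.PosDef := hK.posDef_covarianceMatrix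
  obtain ⟨B, hB⟩ : ∃ B : Matrix (Fin n) (Fin n) ℝ, S = B * B.transpose := by
    obtain ⟨B, hB⟩ := CStarAlgebra.nonneg_iff_eq_star_mul_self.mp hSp.posSemidef.nonneg
    exact ⟨B.transpose, by simpa [Matrix.star_eq_conjTranspose] using hB⟩
  have hdet : S.det = B.det ^ 2 := by rw [hB, Matrix.det_mul, Matrix.det_transpose, sq]
  have hB0 : B.det ≠ 0 := fun h => hSp.det_pos.ne' (by rw [hdet, h]; simp)
  have hBu : IsUnit B.det := hB0.isUnit
  have hA : (σ • B⁻¹).det ≠ 0 := by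
    rw [Matrix.det_smul, Matrix.det_nonsing_inv, Ring.inverse_eq_inv']
    positivity
  set p : EuclideanSpace ℝ (Fin n) := WithLp.toLp 2 fun i => ∫ x, x i ∂(uniformMeasure K) with hp
  refine ⟨matrixAffineHomeomorph _ hA p '' K, hK.image_matrixAffineHomeomorph _ hA p, fun i => ?_,
    ?_, ?_⟩
  · rw [uniformMeasure_image_matrixAffineHomeomorph _ hA p hK.measurableSet,
      integral_map (matrixAffineHomeomorph _ hA p).continuous.aemeasurable (by fun_prop)]
    simp only [matrixAffineHomeomorph_apply_coord]
    have hi : ∀ k, Integrable (fun x : EuclideanSpace ℝ (Fin n) => x k) (uniformMeasure K) :=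
      fun k => (hK.memLp_coord k 1).integrable le_rfl
    rw [integral_finsetSum (f := fun j (x : EuclideanSpace ℝ (Fin n)) =>
      (σ • B⁻¹ : Matrix (Fin n) (Fin n) ℝ) i j * (x j - p j)) _
      fun j _ => ((hi j).sub (integrable_const (p j))).const_mul _]
    refine Finset.sum_eq_zero fun j _ => ?_
    rw [integral_const_mul, integral_sub (hi j) (integrable_const _)]
    simp [hp]
  · rw [covarianceMatrix_image_matrixAffineHomeomorph _ hA p hK, ← hS, hB,
      Matrix.transpose_smul, Matrix.smul_mul, Matrix.mul_smul, Matrix.smul_mul, smul_smul,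
      ← sq, ← Matrix.mul_assoc, Matrix.nonsing_inv_mul _ hBu, Matrix.one_mul,
      ← Matrix.transpose_mul, Matrix.nonsing_inv_mul _ hBu, Matrix.transpose_one]
  · rw [volume_image_matrixAffineHomeomorph, ENNReal.toReal_mul,
      ENNReal.toReal_ofReal (abs_nonneg _), div_pow, hK.isotropicConstant_pow hn, ← hS, hdet,
      Real.sqrt_sq_eq_abs, Matrix.det_smul, Matrix.det_nonsing_inv, Ring.inverse_eq_inv', abs_mul,
      abs_inv, abs_of_pos (pow_pos hσ _), Fintype.card_fin]
    have := ENNReal.toReal_pos hK.volume_ne_zero hK.volume_ne_top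
    have := abs_pos.2 hB0
    field_simp

end

/-! ### Lower bounds for entropy numbers -/

noncomputable section

/-- On this ball the Gaussian `exp(-‖v‖²)` is at least `e^(-k)`, while its total integral is
`π^(k/2)`. Hence the volume is at most `(e√π)^k`, and `e√π < 5`. -/
theorem volume_closedBall_sqrt_le {k : ℕ} :
    volume (Metric.closedBall (0 : EuclideanSpace ℝ (Fin k)) √(k : ℝ)) ≤ ENNReal.ofReal (5 ^ k) := by
  have hI := GaussianFourier.integral_rexp_neg_mul_sq_norm (V := EuclideanSpace ℝ (Fin k))
    (b := 1) one_pos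
  have hpos : 0 < (Real.pi / 1) ^ ((Module.finrank ℝ (EuclideanSpace ℝ (Fin k)) : ℝ) / 2) := by
    positivity
  have hint : Integrable fun v : EuclideanSpace ℝ (Fin k) => Real.exp (-1 * ‖v‖ ^ 2) := by
    by_contra h
    rw [integral_undef h] at hI
    exact hpos.ne hI
  have hmeas : MeasurableSet (Metric.closedBall (0 : EuclideanSpace ℝ (Fin k)) √(k : ℝ)) :=
    Metric.isClosed_closedBall.measurableSet
  have hfin : volume (Metric.closedBall (0 : EuclideanSpace ℝ (Fin k)) √(k : ℝ)) ≠ ⊤ :=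
    measure_closedBall_lt_top.ne
  have h1 : ∫ v in Metric.closedBall (0 : EuclideanSpace ℝ (Fin k)) √(k : ℝ), Real.exp (-(k : ℝ))
      ≤ ∫ v : EuclideanSpace ℝ (Fin k), Real.exp (-1 * ‖v‖ ^ 2) := by
    refine le_trans (setIntegral_mono_on (integrableOn_const hfin) hint.integrableOn hmeas ?_)
      (setIntegral_le_integral hint (Filter.Eventually.of_forall fun v => (Real.exp_pos _).le))
    intro v hv
    have hv' : ‖v‖ ≤ √(k : ℝ) := by simpa using hv
    have : ‖v‖ ^ 2 ≤ (k : ℝ) :=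
      (pow_le_pow_left₀ (norm_nonneg v) hv' 2).trans_eq (Real.sq_sqrt (Nat.cast_nonneg k))
    apply Real.exp_le_exp.2
    linarith
  rw [setIntegral_const, hI, smul_eq_mul, div_one, finrank_euclideanSpace_fin] at h1
  rw [← ENNReal.ofReal_toReal hfin]
  apply ENNReal.ofReal_le_ofReal
  change volume.real _ ≤ _
  have h2 : Real.pi ^ ((k : ℝ) / 2) = √Real.pi ^ k := by
    rw [Real.sqrt_eq_rpow, ← Real.rpow_natCast, ← Real.rpow_mul Real.pi_pos.le]
    congr 1; ring
  have h3 : Real.exp (-(k : ℝ)) = (Real.exp 1 ^ k)⁻¹ := by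
    rw [← Real.exp_nat_mul, mul_one, Real.exp_neg]
  rw [h2, h3, ← div_eq_mul_inv, div_le_iff₀ (by positivity), ← mul_pow] at h1
  refine h1.trans (pow_le_pow_left₀ (by positivity) ?_ k)
  have hs : √Real.pi ≤ 1.8 := by
    rw [Real.sqrt_le_left (by norm_num)]
    linarith [Real.pi_lt_d2]
  nlinarith [Real.exp_one_lt_d9, Real.sqrt_nonneg Real.pi, Real.exp_pos 1]

theorem volume_closedBall_le {k : ℕ} (hk : 1 ≤ k) (c : EuclideanSpace ℝ (Fin k)) {t : ℝ}
    (ht : 0 ≤ t) :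
    volume (Metric.closedBall c t) ≤ ENNReal.ofReal ((5 * t / √(k : ℝ)) ^ k) := by
  have hs : 0 < √(k : ℝ) := Real.sqrt_pos.2 (by exact_mod_cast hk)
  have h := volume_closedBall_sqrt_le (k := k)
  rw [Measure.addHaar_closedBall' _ _ hs.le, finrank_euclideanSpace_fin] at h
  rw [Measure.addHaar_closedBall' _ _ ht, finrank_euclideanSpace_fin]
  calc ENNReal.ofReal (t ^ k) * volume (Metric.closedBall (0 : EuclideanSpace ℝ (Fin k)) 1)
      = ENNReal.ofReal ((t / √(k : ℝ)) ^ k) * (ENNReal.ofReal (√(k : ℝ) ^ k) *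
          volume (Metric.closedBall (0 : EuclideanSpace ℝ (Fin k)) 1)) := by
        rw [← mul_assoc, ← ENNReal.ofReal_mul (by positivity), ← mul_pow, div_mul_cancel₀ _ hs.ne']
    _ ≤ ENNReal.ofReal ((t / √(k : ℝ)) ^ k) * ENNReal.ofReal (5 ^ k) := by gcongr
    _ = _ := by
        rw [← ENNReal.ofReal_mul (by positivity), ← mul_pow]
        congr 2; ring

/-- If `T` is covered by at most `N` balls of radius `t`, its image under a `1`-Lipschitz map has
measure at most `N` times the maximal measure of a ball of radius `t`. -/
theorem measure_le_of_externalCoveringNumber_le {X Y : Type*} [PseudoMetricSpace X]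
    [PseudoMetricSpace Y] [MeasurableSpace Y] (μ : Measure Y) {T : Set X} {S : Set Y} {π : X → Y}
    (hπ : LipschitzWith 1 π) (hS : S ⊆ π '' T) {t : ℝ} {N : ℕ} (ht : 0 ≤ t)
    (hN : Metric.externalCoveringNumber t.toNNReal T ≤ N) {V : ℝ≥0∞}
    (hV : ∀ c, μ (Metric.closedBall c t) ≤ V) : μ S ≤ N * V := by
  obtain ⟨C, hC, hCN⟩ : ∃ C : Set X, Metric.IsCover t.toNNReal T C ∧ C.encard ≤ N := by
    have hlt : Metric.externalCoveringNumber t.toNNReal T < (N : ℕ∞) + 1 := by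
      exact_mod_cast lt_of_le_of_lt hN (by exact_mod_cast Nat.lt_succ_self N)
    simp only [Metric.externalCoveringNumber, iInf_lt_iff] at hlt
    obtain ⟨C, hC, hlt⟩ := hlt
    exact ⟨C, hC, Order.lt_add_one_iff_of_not_isMax (by simp) |>.1 hlt⟩
  have hfin : C.Finite := Set.finite_of_encard_le_coe hCN
  rw [Metric.isCover_iff_subset_iUnion_closedBall, Real.coe_toNNReal _ ht] at hC
  have hcov : S ⊆ ⋃ c ∈ hfin.toFinset, Metric.closedBall (π c) t := by
    intro y hy
    obtain ⟨x, hx, rfl⟩ := hS hy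
    obtain ⟨c, hc, hxc⟩ := Set.mem_iUnion₂.1 (hC hx)
    refine Set.mem_iUnion₂.2 ⟨c, hfin.mem_toFinset.2 hc, ?_⟩
    have := hπ.dist_le_mul x c
    rw [NNReal.coe_one, one_mul] at this
    exact this.trans hxc
  calc μ S ≤ μ (⋃ c ∈ hfin.toFinset, Metric.closedBall (π c) t) := measure_mono hcov
    _ ≤ ∑ c ∈ hfin.toFinset, μ (Metric.closedBall (π c) t) := measure_biUnion_finset_le _ _
    _ ≤ ∑ c ∈ hfin.toFinset, V := Finset.sum_le_sum fun c _ => hV _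
    _ = hfin.toFinset.card * V := by rw [Finset.sum_const, nsmul_eq_mul]
    _ ≤ N * V := by
      gcongr
      rw [hfin.encard_eq_coe_toFinset_card] at hCN
      exact_mod_cast hCN

/-- This makes the set of admissible radii nonempty, without which its infimum would be the default
value `0` and no lower bound could pass to it. -/
theorem Bornology.IsBounded.exists_externalCoveringNumber_le_one {X : Type*} [PseudoMetricSpace X]
    {K : Set X} (hK : Bornology.IsBounded K) :
    ∃ t : ℝ, 0 < t ∧ Metric.externalCoveringNumber t.toNNReal K ≤ 1 := by
  refine ⟨max 1 (Metric.diam K), by positivity, ?_⟩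
  apply Metric.externalCoveringNumber_le_one_of_ediam_le
  rw [← ENNReal.ofReal_toReal hK.ediam_ne_top]
  exact ENNReal.ofReal_le_ofReal (le_max_right _ _)

theorem le_entropyNumber {n k : ℕ} {K : Set (EuclideanSpace ℝ (Fin n))}
    (hK : Bornology.IsBounded K) {r : ℝ}
    (h : ∀ t : ℝ, 0 < t → Metric.externalCoveringNumber t.toNNReal K ≤ 2 ^ k → r ≤ t) :
    r ≤ entropyNumber k K := by
  obtain ⟨t, ht, h1⟩ := hK.exists_externalCoveringNumber_le_one
  exact le_csInf ⟨t, ht, h1.trans (one_le_pow₀ one_le_two)⟩ fun t ht => h t ht.1 ht.2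

theorem entropyNumber_le {n k : ℕ} {K : Set (EuclideanSpace ℝ (Fin n))} {t : ℝ} (ht : 0 < t)
    (h : Metric.externalCoveringNumber t.toNNReal K ≤ 2 ^ k) : entropyNumber k K ≤ t :=
  csInf_le ⟨0, fun _ hs => hs.1.le⟩ ⟨ht, h⟩

/-- Volumetric lower bound for the entropy number of a set with a large `1`-Lipschitz image. -/
theorem le_entropyNumber_of_volume {m k N : ℕ} (hk : 1 ≤ k) {T : Set (EuclideanSpace ℝ (Fin m))}
    (hT : Bornology.IsBounded T) {S : Set (EuclideanSpace ℝ (Fin k))}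
    {π : EuclideanSpace ℝ (Fin m) → EuclideanSpace ℝ (Fin k)}
    (hπ : LipschitzWith 1 π) (hS : S ⊆ π '' T) {b : ℝ}
    (hvol : ENNReal.ofReal (b ^ k) ≤ volume S) :
    b * √(k : ℝ) / (5 * 2 ^ ((N : ℝ) / k)) ≤ entropyNumber N T := by
  refine le_entropyNumber hT fun t ht hcov => ?_
  have h := hvol.trans (measure_le_of_externalCoveringNumber_le volume hπ hS ht.le
    (N := 2 ^ N) (by exact_mod_cast hcov) fun c => volume_closedBall_le hk c ht.le)
  have hs : 0 < √(k : ℝ) := Real.sqrt_pos.2 (by exact_mod_cast hk)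
  have hk0 : (k : ℝ) ≠ 0 := by positivity
  have h2 : ((2 ^ N : ℕ) : ℝ≥0∞) = ENNReal.ofReal (((2 : ℝ) ^ ((N : ℝ) / k)) ^ k) := by
    rw [← Real.rpow_natCast, ← Real.rpow_mul (by norm_num), div_mul_cancel₀ _ hk0,
      Real.rpow_natCast]
    rw [ENNReal.ofReal_pow (by norm_num)]
    simp
  rw [h2, ← ENNReal.ofReal_mul (by positivity), ← mul_pow,
    ENNReal.ofReal_le_ofReal_iff (by positivity)] at h
  have h3 := le_of_pow_le_pow_left₀ (by omega) (by positivity) h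
  rw [div_le_iff₀ (by positivity)]
  calc b * √(k : ℝ) ≤ 2 ^ ((N : ℝ) / k) * (5 * t / √(k : ℝ)) * √(k : ℝ) := by gcongr
    _ = _ := by field_simp

/-- The standard deviation of a coordinate on a convex body is controlled by its entropy. -/
theorem IsConvexBody.le_entropyNumber_of_variance {m N : ℕ} {T : Set (EuclideanSpace ℝ (Fin m))}
    (hT : IsConvexBody T) (i : Fin m) {σ : ℝ}
    (hvar : covarianceMatrix (uniformMeasure T) i i = σ ^ 2) :
    σ / 2 ^ N ≤ entropyNumber N T := by
  have := hT.isProbabilityMeasure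
  refine le_entropyNumber hT.isCompact.isBounded fun t ht hcov => ?_
  have hc : Continuous fun x : EuclideanSpace ℝ (Fin m) => x i := by fun_prop
  have hS : ((fun x : EuclideanSpace ℝ (Fin m) => x i) '' T) = Set.Icc _ _ :=
    eq_Icc_of_connected_compact
      ⟨hT.nonempty.image _, hT.convex.isPreconnected.image _ hc.continuousOn⟩
      (hT.isCompact.image hc)
  set a := sInf ((fun x : EuclideanSpace ℝ (Fin m) => x i) '' T)
  set b := sSup ((fun x : EuclideanSpace ℝ (Fin m) => x i) '' T)
  have hlip : LipschitzWith 1 fun x : EuclideanSpace ℝ (Fin m) => x i :=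
    LipschitzWith.of_dist_le_mul fun x y => by
      simpa [EuclideanSpace.dist_eq, dist_eq_norm] using PiLp.norm_apply_le (x - y) i
  -- The projection is an interval covered by `2^N` intervals of length `2t`, so its length is at
  -- most `2^N · 2t`; a variable on it has standard deviation at most half that length.
  have h := measure_le_of_externalCoveringNumber_le volume hlip hS.ge ht.le
    (N := 2 ^ N) (by exact_mod_cast hcov) fun c => (Real.volume_closedBall c t).le
  rw [Real.volume_Icc, show ((2 ^ N : ℕ) : ℝ≥0∞) = ENNReal.ofReal (2 ^ N) by
    rw [ENNReal.ofReal_pow (by norm_num)]; simp, ← ENNReal.ofReal_mul (by positivity),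
    ENNReal.ofReal_le_ofReal_iff (by positivity)] at h
  have hv : Var[fun x : EuclideanSpace ℝ (Fin m) => x i; uniformMeasure T] ≤ ((b - a) / 2) ^ 2 :=
    variance_le_sq_of_bounded ((ae_cond_mem hT.measurableSet).mono fun x hx =>
      hS.subset (Set.mem_image_of_mem _ hx)) (by fun_prop)
  rw [← covariance_self (by fun_prop)] at hv
  have hab : a ≤ b := by
    obtain ⟨x, hx⟩ := hT.nonempty
    have := hS.subset (Set.mem_image_of_mem _ hx)
    exact this.1.trans this.2
  have h3 : σ ≤ (b - a) / 2 := by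
    refine le_of_sq_le_sq ?_ (by linarith)
    rw [← hvar]; exact hv
  rw [div_le_iff₀ (by positivity)]
  linarith

end

/-! ### Upper bound for entropy by Chebyshev and packing -/

noncomputable section

theorem uniformMeasure_integral_coord {n : ℕ} {K : Set (EuclideanSpace ℝ (Fin n))}
    (hK : IsConvexBody K) (h : ∫ x, x ∂(uniformMeasure K) = 0) (i : Fin n) :
    ∫ x, x i ∂(uniformMeasure K) = 0 := by
  have := hK.isProbabilityMeasure
  have hint : Integrable (fun x => x) (uniformMeasure K) := by
    refine Integrable.of_eval_piLp fun i => (hK.memLp_coord i 1).integrable le_rfl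
  have := (EuclideanSpace.proj (𝕜 := ℝ) i).integral_comp_comm hint
  simpa [h] using this

/-- Chebyshev's inequality: at least three quarters of an isotropic body lies in the ball of
radius `2 L √n`. -/
theorem IsIsotropic.three_quarters_le_volume_inter_closedBall {n : ℕ} (hn : 1 ≤ n)
    {K : Set (EuclideanSpace ℝ (Fin n))} (hK : IsIsotropic K) {L : ℝ} (hL : 0 < L)
    (hcov : covarianceMatrix (uniformMeasure K) = L ^ 2 • (1 : Matrix (Fin n) (Fin n) ℝ)) :
    3 / 4 ≤ volume.real (K ∩ Metric.closedBall 0 (2 * L * √(n : ℝ))) := by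
  have hb := hK.isConvexBody
  have := hb.isProbabilityMeasure
  have hU : uniformMeasure K = volume.restrict K := by
    simp [uniformMeasure, ProbabilityTheory.cond, hK.volume_eq_one]
  have hi : ∀ i, ∫ x, x i ^ 2 ∂(uniformMeasure K) = L ^ 2 := fun i => by
    have h1 := congrFun (congrFun hcov i) i
    simpa [covarianceMatrix, covariance, uniformMeasure_integral_coord hb hK.barycenter_eq_zero,
      ← sq] using h1
  have hsq : ∫ x, ‖x‖ ^ 2 ∂(uniformMeasure K) = n * L ^ 2 := by
    simp_rw [EuclideanSpace.real_norm_sq_eq]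
    rw [integral_finsetSum _ fun i _ => (hb.memLp_of_continuous (by fun_prop) 1).integrable le_rfl]
    simp [hi]
  -- The mean of `‖x‖²` is `nL²`, so Markov's inequality at four times the mean leaves out mass at
  -- most `1/4`.
  have hmk := mul_meas_ge_le_integral_of_nonneg (μ := uniformMeasure K)
    (f := fun x => ‖x‖ ^ 2) (Filter.Eventually.of_forall fun x => by positivity)
    ((hb.memLp_of_continuous (by fun_prop) 1).integrable le_rfl) (4 * (n * L ^ 2))
  rw [hsq] at hmk
  have hn0 : (0 : ℝ) < n := by exact_mod_cast hn
  have hmk' : (uniformMeasure K).real {x | 4 * (n * L ^ 2) ≤ ‖x‖ ^ 2} ≤ 1 / 4 := by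
    have : 0 < n * L ^ 2 := by positivity
    by_contra hcon
    push Not at hcon
    nlinarith
  have hball : MeasurableSet (Metric.closedBall (0 : EuclideanSpace ℝ (Fin n)) (2 * L * √(n : ℝ))) :=
    Metric.isClosed_closedBall.measurableSet
  have hcompl : (uniformMeasure K).real (Metric.closedBall 0 (2 * L * √(n : ℝ)))ᶜ ≤ 1 / 4 := by
    refine (measureReal_mono fun x hx => ?_).trans hmk'
    have hx' : 2 * L * √(n : ℝ) < ‖x‖ := by simpa using hx
    calc 4 * (n * L ^ 2) = (2 * L * √(n : ℝ)) ^ 2 := by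
          rw [mul_pow, Real.sq_sqrt hn0.le]; ring
      _ ≤ ‖x‖ ^ 2 := by gcongr
  rw [probReal_compl_eq_one_sub hball, hU, measureReal_restrict_apply hball, Set.inter_comm] at hcompl
  linarith

open scoped Pointwise in
/-- A packing argument: if most of `K` lies in a ball, then `K` has few separated points. -/
theorem encard_le_of_isSeparated_of_volume {n : ℕ} (hn : 1 ≤ n)
    {K : Set (EuclideanSpace ℝ (Fin n))} (hK : IsConvexBody K) (hvol : volume K = 1) {s : ℝ}
    (hs : 0 ≤ s) (hball : 3 / 4 ≤ volume.real (K ∩ Metric.closedBall 0 s))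
    {C : Set (EuclideanSpace ℝ (Fin n))} (hCK : C ⊆ K)
    (hC : Metric.IsSeparated ((4 * s).toNNReal : ℝ≥0∞) C) : C.encard ≤ 2 ^ n := by
  by_contra! hcon
  obtain ⟨D, hDC, hD⟩ := Set.exists_subset_encard_eq (Order.add_one_le_of_lt hcon)
  have hDfin : D.Finite := Set.finite_of_encard_eq_coe (k := 2 ^ n + 1) (by exact_mod_cast hD)
  have hcard : hDfin.toFinset.card = 2 ^ n + 1 := by
    rw [hDfin.encard_eq_coe_toFinset_card] at hD
    exact_mod_cast hD
  set B := K ∩ Metric.closedBall (0 : EuclideanSpace ℝ (Fin n)) s with hB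
  have hBc : IsCompact B := hK.isCompact.inter_right Metric.isClosed_closedBall
  let P : EuclideanSpace ℝ (Fin n) → Set (EuclideanSpace ℝ (Fin n)) :=
    fun x => (fun y => (1 / 3 : ℝ) • x + y) '' ((2 / 3 : ℝ) • B)
  have hPvol : ∀ x, volume.real (P x) = (2 / 3) ^ n * volume.real B := fun x => by
    simp only [P, measureReal_def]
    rw [Set.image_add_left, measure_preimage_add, Measure.addHaar_smul, ENNReal.toReal_mul,
      finrank_euclideanSpace_fin, abs_of_pos (by positivity), ENNReal.toReal_ofReal (by positivity)]
  have hPmeas : ∀ x, MeasurableSet (P x) := fun x =>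
    ((hBc.smul _).image (by fun_prop)).measurableSet
  have hPsub : ∀ x ∈ D, P x ⊆ K := by
    rintro x hx _ ⟨_, ⟨y, hy, rfl⟩, rfl⟩
    exact hK.convex (hCK (hDC hx)) hy.1 (by norm_num) (by norm_num) (by norm_num)
  have hdisj : (↑hDfin.toFinset : Set _).PairwiseDisjoint P := by
    intro x hx y hy hxy
    rw [hDfin.coe_toFinset] at hx hy
    refine Set.disjoint_left.2 ?_
    rintro _ ⟨_, ⟨u, hu, rfl⟩, rfl⟩ ⟨_, ⟨v, hv, rfl⟩, hEq⟩
    have hsep : ((4 * s).toNNReal : ℝ≥0∞) < edist x y := hC (hDC hx) (hDC hy) hxy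
    rw [edist_dist, ENNReal.ofReal, ENNReal.coe_lt_coe,
      Real.toNNReal_lt_toNNReal_iff_of_nonneg (by positivity), dist_eq_norm] at hsep
    have hu' : ‖u‖ ≤ s := by simpa using hu.2
    have hv' : ‖v‖ ≤ s := by simpa using hv.2
    -- A common point gives `x + 2u = y + 2v`, so `‖x - y‖ ≤ 2(‖u‖ + ‖v‖) ≤ 4s`, against separation.
    have hxy' : x - y = (2 : ℝ) • (v - u) := by
      have h3 := congrArg (fun z => (3 : ℝ) • z) hEq
      simp only [smul_add, smul_smul] at h3
      norm_num at h3
      rw [smul_sub, sub_eq_sub_iff_add_eq_add, h3.symm, add_comm]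
    rw [hxy', norm_smul, Real.norm_eq_abs, abs_two] at hsep
    linarith [norm_sub_le v u]
  have hsum : volume.real (⋃ x ∈ hDfin.toFinset, P x)
      = (2 ^ n + 1) * ((2 / 3) ^ n * volume.real B) := by
    rw [measureReal_biUnion_finset hdisj (fun x _ => hPmeas x)
      fun x _ => ((hBc.smul _).image (by fun_prop)).measure_ne_top]
    simp only [hPvol, Finset.sum_const, hcard, nsmul_eq_mul]
    push_cast
    ring
  have hle : volume.real (⋃ x ∈ hDfin.toFinset, P x) ≤ 1 := by
    calc _ ≤ volume.real K := measureReal_mono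
          (Set.iUnion₂_subset fun x hx => hPsub x (hDfin.mem_toFinset.1 hx)) hK.volume_ne_top
      _ = 1 := by simp [measureReal_def, hvol]
  rw [hsum] at hle
  -- Already `2^n` pieces have total volume at least `(4/3)^n · 3/4 ≥ 1`; the extra piece makes it
  -- exceed the volume of `K`.
  have h43 : (4 / 3 : ℝ) ≤ (4 / 3) ^ n := le_self_pow₀ (by norm_num) (by omega)
  have hpos : (0 : ℝ) < (2 / 3) ^ n := by positivity
  have e : (2 : ℝ) ^ n * (2 / 3) ^ n = (4 / 3) ^ n := by rw [← mul_pow]; norm_num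
  have : (2 ^ n + 1) * ((2 / 3 : ℝ) ^ n * (3 / 4)) ≤ 1 := le_trans (by gcongr) hle
  nlinarith

theorem IsIsotropic.entropyNumber_le {n : ℕ} (hn : 1 ≤ n) {K : Set (EuclideanSpace ℝ (Fin n))}
    (hK : IsIsotropic K) : entropyNumber n K ≤ 8 * isotropicConstant K * √(n : ℝ) := by
  obtain ⟨L, hL, hcov⟩ := hK.cov_eq
  rw [isotropicConstant_eq hn hK.volume_eq_one hL hcov]
  have hn0 : (0 : ℝ) < √(n : ℝ) := Real.sqrt_pos.2 (by exact_mod_cast hn)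
  refine _root_.entropyNumber_le (by positivity) ?_
  rw [show 8 * L * √(n : ℝ) = 4 * (2 * L * √(n : ℝ)) by ring]
  refine (Metric.externalCoveringNumber_le_coveringNumber _ _).trans
    ((Metric.coveringNumber_le_packingNumber _ _).trans ?_)
  refine iSup_le fun C => iSup_le fun hCK => iSup_le fun hC => ?_
  exact encard_le_of_isSeparated_of_volume hn hK.isConvexBody hK.volume_eq_one (by positivity)
    (hK.three_quarters_le_volume_inter_closedBall hn hL hcov) hCK hC

end

/-! ### Products with a cube -/

noncomputable section

/-- Concatenation of coordinates, as a linear homeomorphism. -/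
def euclideanAppend (n k : ℕ) :
    (EuclideanSpace ℝ (Fin n) × (Fin k → ℝ)) ≃L[ℝ] EuclideanSpace ℝ (Fin (n + k)) :=
  LinearEquiv.toContinuousLinearEquiv
    { toFun := fun p => WithLp.toLp 2 (Fin.append p.1 p.2)
      invFun := fun z => (WithLp.toLp 2 fun i => z (Fin.castAdd k i), fun j => z (Fin.natAdd n j))
      map_add' := fun p q => by
        ext i
        refine Fin.addCases (fun i => ?_) (fun i => ?_) i <;> simp
      map_smul' := fun c p => by
        ext i
        refine Fin.addCases (fun i => ?_) (fun i => ?_) i <;> simp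
      left_inv := fun p => by
        refine Prod.ext ?_ ?_
        · ext i; simp
        · ext i; simp
      right_inv := fun z => by
        ext i
        refine Fin.addCases (fun i => ?_) (fun i => ?_) i <;> simp }

variable {n k : ℕ}

@[simp]
theorem euclideanAppend_castAdd (p : EuclideanSpace ℝ (Fin n) × (Fin k → ℝ)) (i : Fin n) :
    euclideanAppend n k p (Fin.castAdd k i) = p.1 i :=
  Fin.append_left (p.1 : Fin n → ℝ) p.2 i

@[simp]
theorem euclideanAppend_natAdd (p : EuclideanSpace ℝ (Fin n) × (Fin k → ℝ)) (j : Fin k) :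
    euclideanAppend n k p (Fin.natAdd n j) = p.2 j :=
  Fin.append_right (p.1 : Fin n → ℝ) p.2 j

/-- The map factors through the plain product of functions, its reindexing over a sum type, and
`finSumFinEquiv`, each of which preserves volume. -/
theorem measurePreserving_euclideanAppend :
    MeasurePreserving (euclideanAppend n k)
      ((volume : Measure (EuclideanSpace ℝ (Fin n))).prod (volume : Measure (Fin k → ℝ))) volume := by
  have h1 := (PiLp.volume_preserving_ofLp (Fin n)).prod
    (MeasurePreserving.id (volume : Measure (Fin k → ℝ)))
  have h2 := volume_measurePreserving_sumPiEquivProdPi_symm (fun _ : Fin n ⊕ Fin k => ℝ)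
  have h3 := volume_measurePreserving_piCongrLeft (fun _ : Fin (n + k) => ℝ) finSumFinEquiv
  have h4 := PiLp.volume_preserving_toLp (Fin (n + k))
  have h := h4.comp (h3.comp (h2.comp h1))
  have he : WithLp.toLp 2 ∘ MeasurableEquiv.piCongrLeft (fun _ : Fin (n + k) => ℝ) finSumFinEquiv ∘
      (MeasurableEquiv.sumPiEquivProdPi fun _ : Fin n ⊕ Fin k => ℝ).symm ∘
        Prod.map WithLp.ofLp id = euclideanAppend n k := by
    funext p
    ext i
    refine Fin.addCases (fun i => ?_) (fun i => ?_) i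
    · rw [euclideanAppend_castAdd, ← finSumFinEquiv_apply_left]
      exact Equiv.piCongrLeft_apply_apply (fun _ : Fin (n + k) => ℝ) finSumFinEquiv _ _
    · rw [euclideanAppend_natAdd, ← finSumFinEquiv_apply_right]
      exact Equiv.piCongrLeft_apply_apply (fun _ : Fin (n + k) => ℝ) finSumFinEquiv _ _
  rw [← he]
  exact h

theorem cond_prod {X Y : Type*} [MeasurableSpace X] [MeasurableSpace Y] {μ : Measure X}
    {ν : Measure Y} [SFinite μ] [SFinite ν] {A : Set X} {B : Set Y} (hA : MeasurableSet A)
    (hB : MeasurableSet B) (hA0 : μ A ≠ 0) (hA' : μ A ≠ ⊤) (hB0 : ν B ≠ 0) (hB' : ν B ≠ ⊤) :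
    (μ.prod ν)[|A ×ˢ B] = μ[|A].prod ν[|B] := by
  have := cond_isProbabilityMeasure_of_finite hA0 hA'
  have := cond_isProbabilityMeasure_of_finite hB0 hB'
  refine (Measure.prod_eq fun s t hs ht => ?_).symm
  rw [cond_apply (hA.prod hB), cond_apply hA, cond_apply hB, Set.prod_inter_prod,
    Measure.prod_prod, Measure.prod_prod, ENNReal.mul_inv (.inl hA0) (.inl hA')]
  ring

theorem cond_univ_pi {ι : Type*} [Fintype ι] {X : ι → Type*} [∀ i, MeasurableSpace (X i)]
    {μ : ∀ i, Measure (X i)} [∀ i, SigmaFinite (μ i)] {A : ∀ i, Set (X i)}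
    (hA : ∀ i, MeasurableSet (A i)) (hA0 : ∀ i, μ i (A i) ≠ 0) (hA' : ∀ i, μ i (A i) ≠ ⊤) :
    (Measure.pi μ)[|Set.univ.pi A] = Measure.pi fun i => (μ i)[|A i] := by
  have := fun i => cond_isProbabilityMeasure_of_finite (hA0 i) (hA' i)
  refine (Measure.pi_eq fun s hs => ?_).symm
  rw [cond_apply (MeasurableSet.univ_pi hA), ← Set.pi_inter_distrib, Measure.pi_pi, Measure.pi_pi,
    ENNReal.prod_inv_distrib fun i _ j _ _ => .inl (hA0 i), ← Finset.prod_mul_distrib]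
  exact Finset.prod_congr rfl fun i _ => (cond_apply (hA i) _ _).symm

/-- The uniform probability measure on the interval `[-b/2, b/2]`. -/
def uniformInterval (b : ℝ) : Measure ℝ := (volume : Measure ℝ)[|Set.Icc (-(b / 2)) (b / 2)]

theorem uniformInterval_isProbabilityMeasure {b : ℝ} (hb : 0 < b) :
    IsProbabilityMeasure (uniformInterval b) :=
  cond_isProbabilityMeasure_of_finite (by simp [hb]) (by simp)

theorem integral_uniformInterval {b : ℝ} (hb : 0 < b) (f : ℝ → ℝ) :
    ∫ x, f x ∂(uniformInterval b) = b⁻¹ * ∫ x in (-(b / 2))..(b / 2), f x := by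
  rw [uniformInterval, ProbabilityTheory.cond, integral_smul_measure, intervalIntegral.integral_of_le (by linarith),
    integral_Icc_eq_integral_Ioc, Real.volume_Icc, sub_neg_eq_add, add_halves, ENNReal.toReal_inv,
    ENNReal.toReal_ofReal hb.le, smul_eq_mul]

theorem integral_id_uniformInterval {b : ℝ} (hb : 0 < b) : ∫ x, x ∂(uniformInterval b) = 0 := by
  rw [integral_uniformInterval hb, integral_id]; ring

theorem variance_uniformInterval {b : ℝ} (hb : 0 < b) :
    cov[fun x => x, fun x => x; uniformInterval b] = b ^ 2 / 12 := by
  simp only [covariance, integral_id_uniformInterval hb, sub_zero, ← sq]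
  rw [integral_uniformInterval hb, integral_pow]
  field_simp
  ring

theorem memLp_id_uniformInterval {b : ℝ} (hb : 0 < b) (p : ℝ≥0∞) :
    MemLp (fun x => x) p (uniformInterval b) := by
  have := uniformInterval_isProbabilityMeasure hb
  refine memLp_of_bounded (a := -(b / 2)) (b := b / 2) (ae_cond_mem measurableSet_Icc)
    (by fun_prop) p

theorem volume_cube {b : ℝ} (hb : 0 < b) :
    volume (Set.univ.pi fun _ : Fin k => Set.Icc (-(b / 2)) (b / 2)) = ENNReal.ofReal (b ^ k) := by
  rw [volume_pi_pi]
  simp [ENNReal.ofReal_pow hb.le]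

/-- The product of `K` with the cube `[-b/2, b/2]ᵏ`. -/
def prodCube (k : ℕ) (K : Set (EuclideanSpace ℝ (Fin n))) (b : ℝ) :
    Set (EuclideanSpace ℝ (Fin (n + k))) :=
  euclideanAppend n k '' (K ×ˢ Set.univ.pi fun _ => Set.Icc (-(b / 2)) (b / 2))

variable {K : Set (EuclideanSpace ℝ (Fin n))} {b : ℝ}

theorem IsConvexBody.prodCube (hK : IsConvexBody K) (hb : 0 < b) :
    IsConvexBody (prodCube k K b) where
  convex := (hK.convex.prod (convex_pi fun _ _ => convex_Icc _ _)).linear_image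
    (euclideanAppend n k).toLinearEquiv.toLinearMap
  isCompact := (hK.isCompact.prod (isCompact_univ_pi fun _ => isCompact_Icc)).image
    (euclideanAppend n k).continuous
  interior_nonempty := by
    change (interior ((euclideanAppend n k).toHomeomorph '' _)).Nonempty
    rw [← (euclideanAppend n k).toHomeomorph.image_interior]
    refine Set.Nonempty.image _ ?_
    rw [interior_prod_eq, interior_pi_set Set.finite_univ]
    refine hK.interior_nonempty.prod (Set.univ_pi_nonempty_iff.2 fun _ => ?_)
    rw [interior_Icc, Set.nonempty_Ioo]
    linarith

theorem volume_prodCube (hb : 0 < b) :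
    volume (prodCube k K b) = volume K * ENNReal.ofReal (b ^ k) := by
  have h := (measurePreserving_euclideanAppend (n := n) (k := k)).measure_preimage_equiv
    (f := (euclideanAppend n k).toHomeomorph.toMeasurableEquiv) (prodCube k K b)
  change ((volume : Measure (EuclideanSpace ℝ (Fin n))).prod (volume : Measure (Fin k → ℝ)))
    (euclideanAppend n k ⁻¹' prodCube k K b) = _ at h
  rw [← h, prodCube, Set.preimage_image_eq _ (euclideanAppend n k).injective, Measure.prod_prod,
    volume_cube hb]

theorem uniformMeasure_prodCube (hK : IsConvexBody K) (hb : 0 < b) :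
    uniformMeasure (prodCube k K b)
      = ((uniformMeasure K).prod (Measure.pi fun _ : Fin k => uniformInterval b)).map
          (euclideanAppend n k) := by
  have := hK.isProbabilityMeasure
  have := uniformInterval_isProbabilityMeasure hb
  have hm : MeasurableSet (K ×ˢ Set.univ.pi fun _ : Fin k => Set.Icc (-(b / 2)) (b / 2)) :=
    hK.measurableSet.prod (MeasurableSet.univ_pi fun _ => measurableSet_Icc)
  have h := cond_map_measurableEquiv (euclideanAppend n k).toHomeomorph.toMeasurableEquiv
    (ν := volume) (c := 1) one_ne_zero ENNReal.one_ne_top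
    (by rw [one_smul]; exact (measurePreserving_euclideanAppend (n := n) (k := k)).map_eq) hm
  refine h.symm.trans ?_
  change Measure.map (euclideanAppend n k) _ = _
  have hI : (volume : Measure (Fin k → ℝ))[|Set.univ.pi fun _ => Set.Icc (-(b / 2)) (b / 2)]
      = Measure.pi fun _ : Fin k => uniformInterval b := by
    rw [volume_pi]
    exact cond_univ_pi (fun _ => measurableSet_Icc) (fun _ => by simp [hb]) fun _ => by simp
  rw [cond_prod hK.measurableSet (MeasurableSet.univ_pi fun _ => measurableSet_Icc)
    hK.volume_ne_zero hK.volume_ne_top (by rw [volume_cube hb]; simpa using pow_pos hb k)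
    (by rw [volume_cube hb]; simp), hI]
  rfl

/-- Independence of the factors kills the mixed entries, and the hypothesis on `K` is matched to the
variance `b²/12` of the interval, so both diagonal blocks carry the same scalar. -/
theorem covarianceMatrix_prodCube (hK : IsConvexBody K) (hb : 0 < b)
    (hcov : covarianceMatrix (uniformMeasure K)
      = (b ^ 2 / 12) • (1 : Matrix (Fin n) (Fin n) ℝ)) :
    covarianceMatrix (uniformMeasure (prodCube k K b))
      = (b ^ 2 / 12) • (1 : Matrix (Fin (n + k)) (Fin (n + k)) ℝ) := by
  have := hK.isProbabilityMeasure
  have := uniformInterval_isProbabilityMeasure hb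
  rw [uniformMeasure_prodCube hK hb]
  set μ := uniformMeasure K
  set ν := Measure.pi fun _ : Fin k => uniformInterval b
  have hν : ∀ j, MemLp (fun y : Fin k → ℝ => y j) 2 ν := fun j =>
    (memLp_id_uniformInterval hb 2).comp_measurePreserving (measurePreserving_eval _ j)
  have hcast : ∀ i j : Fin n, cov[fun x => x i, fun x => x j; μ] = ((b ^ 2 / 12) •
      (1 : Matrix (Fin n) (Fin n) ℝ)) i j := fun i j => by rw [← hcov]; rfl
  have hfst : ∀ i j : Fin n, cov[fun p => p.1 i, fun p => p.1 j; μ.prod ν]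
      = cov[fun x => x i, fun x => x j; μ] := fun i j => by
    have h : (μ.prod ν).map Prod.fst = μ := by simp
    conv_rhs => rw [← h]
    rw [covariance_map_fun (by fun_prop) (by fun_prop) (by fun_prop)]
  have hsnd : ∀ i j : Fin k, cov[fun p => p.2 i, fun p => p.2 j; μ.prod ν]
      = cov[fun x => x i, fun x => x j; ν] := fun i j => by
    have h : (μ.prod ν).map Prod.snd = ν := by simp
    conv_rhs => rw [← h]
    rw [covariance_map_fun (measurable_pi_apply i).aestronglyMeasurable
      (measurable_pi_apply j).aestronglyMeasurable (by fun_prop)]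
  have hself : ∀ i, cov[fun x => x i, fun x => x i; ν] = b ^ 2 / 12 := fun i => by
    have h : ν.map (fun y => y i) = uniformInterval b := (measurePreserving_eval _ i).map_eq
    rw [← variance_uniformInterval hb, ← h]
    exact (covariance_map_fun (X := fun x : ℝ => x) (Y := fun x : ℝ => x) (μ := ν)
      (Z := fun y : Fin k → ℝ => y i) (by fun_prop) (by fun_prop)
      (measurable_pi_apply i).aemeasurable).symm
  have hne : ∀ i j, i ≠ j → cov[fun x => x i, fun x => x j; ν] = 0 := fun i j hij =>
    ((iIndepFun_pi (X := fun _ : Fin k => fun x : ℝ => x)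
      (μ := fun _ => uniformInterval b) fun i => by fun_prop).indepFun hij).covariance_eq_zero
      (hν i) (hν j)
  have hmix : ∀ (i : Fin n) (j : Fin k), cov[fun p => p.1 i, fun p => p.2 j; μ.prod ν] = 0 :=
    fun i j => covariance_fst_snd_prod (hK.memLp_coord i 2) (hν j)
  have hca : ∀ (i : Fin n) (j : Fin k), Fin.castAdd k i ≠ Fin.natAdd n j := fun i j h => by
    have := congrArg Fin.val h
    simp only [Fin.val_castAdd, Fin.val_natAdd] at this
    omega
  ext i j
  rw [covarianceMatrix, Matrix.of_apply, covariance_map_fun (by fun_prop) (by fun_prop)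
    (euclideanAppend n k).continuous.aemeasurable]
  refine Fin.addCases (fun i => ?_) (fun i => ?_) i <;>
  refine Fin.addCases (fun j => ?_) (fun j => ?_) j
  · simp only [euclideanAppend_castAdd]
    rw [hfst, hcast]
    simp [Matrix.one_apply]
  · simp only [euclideanAppend_castAdd, euclideanAppend_natAdd]
    rw [hmix]
    simp [Matrix.one_apply_ne (hca i j)]
  · simp only [euclideanAppend_castAdd, euclideanAppend_natAdd]
    rw [covariance_comm, hmix]
    simp [Matrix.one_apply_ne (hca j i).symm]
  · simp only [euclideanAppend_natAdd]
    rw [hsnd]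
    by_cases hij : i = j
    · subst hij
      rw [hself]
      simp
    · rw [hne i j hij]
      simp [hij]

theorem IsConvexBody.isIsotropic_prodCube (hK : IsConvexBody K) (hb : 0 < b)
    (hmean : ∀ i, ∫ x, x i ∂(uniformMeasure K) = 0)
    (hcov : covarianceMatrix (uniformMeasure K)
      = (b ^ 2 / 12) • (1 : Matrix (Fin n) (Fin n) ℝ))
    (hvol : (volume K).toReal * b ^ k = 1) : IsIsotropic (_root_.prodCube k K b) where
  isConvexBody := hK.prodCube hb
  volume_eq_one := by
    rw [volume_prodCube hb, ← ENNReal.ofReal_toReal hK.volume_ne_top,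
      ← ENNReal.ofReal_mul ENNReal.toReal_nonneg, hvol, ENNReal.ofReal_one]
  barycenter_eq_zero := by
    have := hK.isProbabilityMeasure
    have := uniformInterval_isProbabilityMeasure hb
    have := (hK.prodCube (k := k) hb).isProbabilityMeasure
    have hint : ∀ i, Integrable (fun x => x i) (uniformMeasure (_root_.prodCube k K b)) := fun i =>
      ((hK.prodCube hb).memLp_coord i 1).integrable le_rfl
    ext i
    rw [eval_integral_piLp hint, uniformMeasure_prodCube hK hb,
      integral_map (euclideanAppend n k).continuous.aemeasurable (by fun_prop)]
    refine Fin.addCases (fun i => ?_) (fun i => ?_) i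
    · simp only [euclideanAppend_castAdd]
      rw [integral_fun_fst (fun x : EuclideanSpace ℝ (Fin n) => x i), hmean]
      simp
    · simp only [euclideanAppend_natAdd]
      rw [integral_fun_snd (fun x : Fin k → ℝ => x i)]
      have h : (Measure.pi fun _ : Fin k => uniformInterval b).map (fun y => y i)
          = uniformInterval b := (measurePreserving_eval _ i).map_eq
      have h0 := integral_id_uniformInterval hb
      rw [← h, integral_map (measurable_pi_apply i).aemeasurable (by fun_prop)] at h0
      simp [h0]
  cov_eq := ⟨b / √12, by positivity, by
    rw [covarianceMatrix_prodCube hK hb hcov, div_pow, Real.sq_sqrt (by norm_num)]⟩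

/-- The projection onto the last coordinates. -/
theorem exists_lipschitz_image_prodCube (hK : K.Nonempty) (hb : 0 < b) :
    ∃ (π : EuclideanSpace ℝ (Fin (n + k)) → EuclideanSpace ℝ (Fin k))
      (S : Set (EuclideanSpace ℝ (Fin k))), LipschitzWith 1 π ∧ S ⊆ π '' prodCube k K b ∧
      ENNReal.ofReal (b ^ k) ≤ volume S := by
  refine ⟨fun z => WithLp.toLp 2 fun j => z (Fin.natAdd n j),
    WithLp.toLp 2 '' (Set.univ.pi fun _ => Set.Icc (-(b / 2)) (b / 2)), ?_, ?_, ?_⟩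
  · refine LipschitzWith.of_dist_le_mul fun x y => ?_
    rw [NNReal.coe_one, one_mul, EuclideanSpace.dist_eq, EuclideanSpace.dist_eq, Fin.sum_univ_add]
    exact Real.sqrt_le_sqrt (le_add_of_nonneg_left (by positivity))
  · obtain ⟨x, hx⟩ := hK
    rintro _ ⟨y, hy, rfl⟩
    refine ⟨euclideanAppend n k (x, y), ⟨(x, y), ⟨hx, hy⟩, rfl⟩, ?_⟩
    ext j
    simp
  · rw [← volume_cube hb]
    have h := (PiLp.volume_preserving_toLp (Fin k)).measure_preimage_equiv
      (f := MeasurableEquiv.toLp 2 (Fin k → ℝ))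
      (WithLp.toLp 2 '' (Set.univ.pi fun _ => Set.Icc (-(b / 2)) (b / 2)))
    rw [← h]
    exact measure_mono (Set.subset_preimage_image _ _)

end

/-! ### Bounding the isotropic constant by entropy -/

noncomputable section

variable {n k : ℕ} {K : Set (EuclideanSpace ℝ (Fin n))}

/-- Any convex body of dimension `n` with isotropic constant `L_K` yields an isotropic convex body
of dimension `n + k` which is a product with a cube of side length `b`, `b^{n+k} = (√12 L_K)^n`. -/
theorem IsConvexBody.exists_isIsotropic_prodCube (hn : 1 ≤ n) (hK : IsConvexBody K) {b : ℝ}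
    (hb : 0 < b) (hbK : b ^ (n + k) = (√12 * isotropicConstant K) ^ n) :
    ∃ K' : Set (EuclideanSpace ℝ (Fin n)), IsConvexBody K' ∧
      IsIsotropic (_root_.prodCube k K' b) ∧
      covarianceMatrix (uniformMeasure (_root_.prodCube k K' b))
        = (b ^ 2 / 12) • (1 : Matrix (Fin (n + k)) (Fin (n + k)) ℝ) := by
  obtain ⟨K', hK', hmean, hcov, hvol⟩ :=
    hK.exists_scaled_isotropic_position hn (σ := b / √12) (by positivity)
  rw [div_pow, Real.sq_sqrt (by norm_num)] at hcov
  refine ⟨K', hK', hK'.isIsotropic_prodCube hb hmean hcov ?_, covarianceMatrix_prodCube hK' hb hcov⟩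
  have := hK.isotropicConstant_pos
  rw [hvol, div_div, div_pow, ← hbK, pow_add]
  field_simp

theorem one_tenth_le_entropyNumber {m : ℕ} (hm : 1 ≤ m) {T : Set (EuclideanSpace ℝ (Fin m))}
    (hT : IsConvexBody T) (hvol : volume T = 1) :
    1 / 10 ≤ entropyNumber m T / √(m : ℝ) := by
  have hs : 0 < √(m : ℝ) := Real.sqrt_pos.2 (by exact_mod_cast hm)
  have h := le_entropyNumber_of_volume (N := m) hm hT.isCompact.isBounded (b := 1) (S := T)
    LipschitzWith.id (by simp) (by simp [hvol])
  rw [div_self (by positivity), Real.rpow_one] at h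
  rw [le_div_iff₀ hs]
  linarith

/-- The cube factor forces the entropy number to be large. -/
theorem le_entropyNumber_prodCube {b lam : ℝ} (hn : 1 ≤ n) (hK : IsConvexBody K) (hb : 0 < b)
    (hcov : covarianceMatrix (uniformMeasure (prodCube k K b))
        = (b ^ 2 / 12) • (1 : Matrix (Fin (n + k)) (Fin (n + k)) ℝ))
    (hlam : lam ∈ Set.Ioc (0 : ℝ) 1) (hk : ⌊(1 + lam) * (n : ℝ)⌋₊ = n + k) :
    b ≤ 7 * 256 ^ (1 / lam) * (entropyNumber (n + k) (prodCube k K b) / √((n + k : ℕ) : ℝ)) := by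
  obtain ⟨h0, h1⟩ := hlam
  have hT := hK.prodCube (k := k) hb
  have hn0 : (1 : ℝ) ≤ n := by exact_mod_cast hn
  have hle := Nat.floor_le (a := (1 + lam) * (n : ℝ)) (by positivity)
  have hlt := Nat.lt_floor_add_one ((1 + lam) * (n : ℝ))
  rw [hk] at hle hlt
  push_cast at hle hlt
  have hs : 0 < √((n + k : ℕ) : ℝ) := Real.sqrt_pos.2 (by exact_mod_cast (by omega))
  set e := entropyNumber (n + k) (prodCube k K b) with he
  rcases Nat.eq_zero_or_pos k with hk0 | hkpos
  -- With no cube factor, rounding down forces `λn < 1`. The one-coordinate bound `b/√12 ≤ 2^m e`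
  -- then suffices, as `2^m` is at most `2^(1/λ)`.
  · have hln : (n : ℝ) ≤ 1 / lam := by
      rw [le_div_iff₀ h0]
      rw [hk0] at hlt
      push_cast at hlt
      linarith
    have hv := hT.le_entropyNumber_of_variance (N := n + k) ⟨0, by omega⟩ (σ := b / √12) (by
      rw [hcov, div_pow, Real.sq_sqrt (by norm_num)]; simp)
    rw [← he, div_div, div_le_iff₀ (by positivity)] at hv
    have h12 : √12 ≤ (7 / 2 : ℝ) := by
      rw [Real.sqrt_le_left (by norm_num)]; norm_num
    have hnk : ((n + k : ℕ) : ℝ) ≤ 1 / lam := by rw [hk0]; simpa using hln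
    set m := n + k
    have hm1 : 1 ≤ m := by omega
    have hsm : √(m : ℝ) ≤ 2 ^ m := by
      rw [Real.sqrt_le_left (by positivity)]
      have h2 : (m : ℝ) ≤ 2 ^ m := by exact_mod_cast Nat.lt_two_pow_self.le
      nlinarith [one_le_pow₀ (one_le_two (α := ℝ)) (n := m)]
    have h256 : (2 : ℝ) ^ m * 2 ^ m ≤ 256 ^ (1 / lam) := by
      rw [← mul_pow, ← Real.rpow_natCast]
      calc ((2 : ℝ) * 2) ^ (m : ℝ) ≤ 256 ^ (m : ℝ) :=
            Real.rpow_le_rpow (by norm_num) (by norm_num) (by positivity)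
        _ ≤ 256 ^ (1 / lam) := Real.rpow_le_rpow_of_exponent_le (by norm_num) hnk
    have hepos : 0 < e / √(m : ℝ) := by
      refine div_pos ?_ hs
      by_contra! hneg
      have := mul_nonpos_of_nonpos_of_nonneg hneg (show (0 : ℝ) ≤ √12 * 2 ^ m by positivity)
      linarith
    calc b ≤ e * (√12 * 2 ^ m) := hv
      _ = √12 * (2 ^ m * √(m : ℝ)) * (e / √(m : ℝ)) := by field_simp
      _ ≤ 7 * (2 ^ m * 2 ^ m) * (e / √(m : ℝ)) := by gcongr; linarith
      _ ≤ 7 * 256 ^ (1 / lam) * (e / √(m : ℝ)) := by gcongr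
  · obtain ⟨π, S, hπ, hS, hvol⟩ := exists_lipschitz_image_prodCube (k := k) hK.nonempty hb
    have hv := le_entropyNumber_of_volume (N := n + k) hkpos hT.isCompact.isBounded hπ hS hvol
    have hk1 : (1 : ℝ) ≤ k := by exact_mod_cast hkpos
    have hsk : 0 < √(k : ℝ) := Real.sqrt_pos.2 (by linarith)
    rw [← he, div_le_iff₀ (by positivity)] at hv
    set r := ((n + k : ℕ) : ℝ) / k with hr
    have hr1 : 1 ≤ r := by rw [hr, le_div_iff₀ (by linarith)]; push_cast; linarith
    -- From `λn < k + 1 ≤ 2k` and `n + k ≤ 2n`. Since `4^r ≤ 4^(4/λ)`, this is the source of `256 =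
    -- 4^4`.
    have hr4 : r ≤ 4 * (1 / lam) := by
      rw [hr, div_le_iff₀ (by linarith), mul_one_div, div_mul_eq_mul_div, le_div_iff₀ h0]
      push_cast
      have : lam * n ≤ 2 * k := by linarith
      nlinarith
    have hsr : √((n + k : ℕ) : ℝ) ≤ 2 ^ r * √(k : ℝ) := by
      have : √((n + k : ℕ) : ℝ) = √r * √(k : ℝ) := by
        rw [← Real.sqrt_mul (by linarith), hr, div_mul_cancel₀ _ (by linarith)]
      rw [this]
      gcongr
      have hbern := one_add_mul_self_le_rpow_one_add (s := 1) (by norm_num) hr1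
      norm_num at hbern
      rw [Real.sqrt_le_left (by positivity)]
      nlinarith
    have h256 : (2 : ℝ) ^ r * 2 ^ r ≤ 256 ^ (1 / lam) := by
      rw [← Real.mul_rpow (by norm_num) (by norm_num)]
      calc ((2 : ℝ) * 2) ^ r ≤ (2 * 2) ^ (4 * (1 / lam)) :=
            Real.rpow_le_rpow_of_exponent_le (by norm_num) hr4
        _ = 256 ^ (1 / lam) := by
          rw [Real.rpow_mul (by norm_num)]; norm_num
    have hepos : 0 < e := by
      by_contra! hneg
      have h3 : 0 < b * √(k : ℝ) := by positivity
      have := mul_nonpos_of_nonpos_of_nonneg hneg (show (0 : ℝ) ≤ 5 * 2 ^ r by positivity)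
      linarith
    calc b = b * √(k : ℝ) / √(k : ℝ) := by field_simp
      _ ≤ e * (5 * 2 ^ r) / √(k : ℝ) := by gcongr
      _ = 5 * (2 ^ r * √((n + k : ℕ) : ℝ)) / √(k : ℝ) * (e / √((n + k : ℕ) : ℝ)) := by field_simp
      _ ≤ 5 * (2 ^ r * (2 ^ r * √(k : ℝ))) / √(k : ℝ) * (e / √((n + k : ℕ) : ℝ)) := by gcongr
      _ = 5 * (2 ^ r * 2 ^ r) * (e / √((n + k : ℕ) : ℝ)) := by field_simp
      _ ≤ 7 * 256 ^ (1 / lam) * (e / √((n + k : ℕ) : ℝ)) := by gcongr; norm_num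

theorem IsConvexBody.exists_isIsotropic_isotropicConstant_le (hn : 1 ≤ n) (hK : IsConvexBody K)
    {lam : ℝ} (hlam : lam ∈ Set.Ioc (0 : ℝ) 1) :
    ∃ T : Set (EuclideanSpace ℝ (Fin ⌊(1 + lam) * (n : ℝ)⌋₊)), IsIsotropic T ∧
      isotropicConstant K ≤ (2560 ^ 2 : ℝ) ^ (1 / lam) *
        (entropyNumber ⌊(1 + lam) * (n : ℝ)⌋₊ T / √(⌊(1 + lam) * (n : ℝ)⌋₊ : ℝ)) ^ (1 + lam) := by
  have hlam' := hlam
  obtain ⟨h0, h1⟩ := hlam'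
  have hn0 : (1 : ℝ) ≤ n := by exact_mod_cast hn
  have hL := hK.isotropicConstant_pos
  have hge : n ≤ ⌊(1 + lam) * (n : ℝ)⌋₊ := Nat.le_floor (by nlinarith)
  have hle := Nat.floor_le (a := (1 + lam) * (n : ℝ)) (by positivity)
  obtain ⟨k, hk⟩ := Nat.exists_eq_add_of_le hge
  -- The side length for which the product with the cube has volume one.
  set b : ℝ := (√12 * isotropicConstant K) ^ ((n : ℝ) / (n + k : ℕ)) with hb
  have hb0 : 0 < b := by positivity
  have hbK : b ^ (n + k) = (√12 * isotropicConstant K) ^ n := by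
    rw [hb, ← Real.rpow_natCast, ← Real.rpow_mul (by positivity), div_mul_cancel₀ _ (by positivity),
      Real.rpow_natCast]
  obtain ⟨K', hK', hT, hcov⟩ := hK.exists_isIsotropic_prodCube hn hb0 hbK
  have hbe := le_entropyNumber_prodCube hn hK' hb0 hcov hlam hk
  have he := one_tenth_le_entropyNumber (by omega) hT.isConvexBody hT.volume_eq_one
  rw [hk] at hle ⊢
  refine ⟨_, hT, ?_⟩
  set e := entropyNumber (n + k) (_root_.prodCube k K' b) / √((n + k : ℕ) : ℝ)
  have he0 : 0 < e := by linarith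
  have hlinv : 1 ≤ 1 / lam := by rwa [le_div_iff₀ h0, one_mul]
  -- The extra factor `10` in `2560 = 10 · 256` absorbs the `7` and, with `e ≥ 1/10`, ensures `D ≥
  -- 1`; this is needed to enlarge the exponent `(n+k)/n` to `1 + λ`.
  set D : ℝ := 2560 ^ (1 / lam) * e with hD
  have h10 : (10 : ℝ) ≤ 10 ^ (1 / lam) := Real.self_le_rpow_of_one_le (by norm_num) hlinv
  have hsplit : (2560 : ℝ) ^ (1 / lam) = 10 ^ (1 / lam) * 256 ^ (1 / lam) := by
    rw [← Real.mul_rpow (by norm_num) (by norm_num)]; norm_num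
  have hbD : b ≤ D := by
    refine hbe.trans ?_
    rw [hD, hsplit]
    gcongr
    linarith
  have hD1 : 1 ≤ D := by
    have : (1 : ℝ) ≤ 256 ^ (1 / lam) := Real.one_le_rpow (by norm_num) (by positivity)
    rw [hD, hsplit]
    calc (1 : ℝ) = 10 * 1 * (1 / 10) := by norm_num
      _ ≤ _ := by gcongr
  have hexp : ((n + k : ℕ) : ℝ) / n ≤ 1 + lam := by
    rw [div_le_iff₀ (by linarith)]; exact hle
  calc isotropicConstant K ≤ √12 * isotropicConstant K :=
        le_mul_of_one_le_left hL.le (Real.one_le_sqrt.2 (by norm_num))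
    _ = b ^ (((n + k : ℕ) : ℝ) / n) := by
      rw [hb, ← Real.rpow_mul (by positivity)]
      have : ((n : ℝ) / (n + k : ℕ)) * (((n + k : ℕ) : ℝ) / n) = 1 := by field_simp
      rw [this, Real.rpow_one]
    _ ≤ D ^ (((n + k : ℕ) : ℝ) / n) := Real.rpow_le_rpow hb0.le hbD (by positivity)
    _ ≤ D ^ (1 + lam) := Real.rpow_le_rpow_of_exponent_le hD1 hexp
    _ = (2560 ^ (1 / lam)) ^ (1 + lam) * e ^ (1 + lam) :=
      Real.mul_rpow (by positivity) he0.le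
    -- The exponent `(1 + λ)/λ` is at most `2/λ` because `λ ≤ 1`, whence the square.
    _ ≤ (2560 ^ 2) ^ (1 / lam) * e ^ (1 + lam) := by
      gcongr
      rw [← Real.rpow_natCast 2560 2, ← Real.rpow_mul (by norm_num), ← Real.rpow_mul (by norm_num)]
      refine Real.rpow_le_rpow_of_exponent_le (by norm_num) ?_
      push_cast
      rw [mul_comm]
      gcongr
      linarith

end
-- Passage to suprema
theorem proposition4p2 :
    ∃ C : ℝ, 0 < C ∧ ∀ n : ℕ, 1 ≤ n →
      (maxIsotropicConstant n ≤
        ⨅ (lam : ℝ) (_ : lam ∈ Set.Ioc (0 : ℝ) 1),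
          ENNReal.ofReal C ^ (1 / lam) *
            maxEntropyNumber ⌊(1 + lam) * (n : ℝ)⌋₊ ^ (1 + lam)) ∧
      (∀ K : Set (EuclideanSpace ℝ (Fin n)), IsIsotropic K →
        entropyNumber n K ≤ C * isotropicConstant K * √(n : ℝ)) ∧
      maxEntropyNumber n ≤ ENNReal.ofReal C * maxIsotropicConstant n := by
  have hmul : ∀ n : ℕ, 1 ≤ n → ∀ K : Set (EuclideanSpace ℝ (Fin n)), IsIsotropic K →
      entropyNumber n K ≤ 2560 ^ 2 * isotropicConstant K * √(n : ℝ) := fun n hn K hK => by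
    refine (hK.entropyNumber_le hn).trans ?_
    have := hK.isConvexBody.isotropicConstant_pos
    gcongr
    norm_num
  refine ⟨2560 ^ 2, by norm_num, fun n hn => ⟨?_, hmul n hn, ?_⟩⟩
  · refine le_iInf₂ fun lam hlam => iSup₂_le fun K hK => ?_
    obtain ⟨h0, h1⟩ := hlam
    obtain ⟨T, hT, hle⟩ := hK.exists_isIsotropic_isotropicConstant_le hn ⟨h0, h1⟩
    refine (ENNReal.ofReal_le_ofReal hle).trans ?_
    rw [ENNReal.ofReal_mul (by positivity), ← ENNReal.ofReal_rpow_of_pos (by norm_num)]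
    have he : 0 ≤ entropyNumber ⌊(1 + lam) * (n : ℝ)⌋₊ T / √(⌊(1 + lam) * (n : ℝ)⌋₊ : ℝ) :=
      div_nonneg (Real.sInf_nonneg fun t ht => ht.1.le) (Real.sqrt_nonneg _)
    rw [← ENNReal.ofReal_rpow_of_nonneg he (by linarith)]
    gcongr
    exact le_iSup₂_of_le T hT le_rfl
  · refine iSup₂_le fun K hK => ?_
    have hs : 0 < √(n : ℝ) := Real.sqrt_pos.2 (by exact_mod_cast hn)
    calc ENNReal.ofReal (entropyNumber n K / √(n : ℝ))
        ≤ ENNReal.ofReal (2560 ^ 2 * isotropicConstant K) :=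
          ENNReal.ofReal_le_ofReal ((div_le_iff₀ hs).2 (hmul n hn K hK))
      _ = ENNReal.ofReal (2560 ^ 2) * ENNReal.ofReal (isotropicConstant K) :=
          ENNReal.ofReal_mul (by norm_num)
      _ ≤ _ := by
        gcongr
        exact le_iSup₂_of_le K hK.isConvexBody le_rfl
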